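/- Let $G$ be a complex semisimple Lie group, that is, a finite-dimensional complex Lie group with finitely many connected components (for example, a connected one) whose Lie algebra $\mathfrak g$ is a semisimple Lie algebra over $\mathbb C$. Call $u\in G$ *unipotent* if there is a faithful finite-dimensional holomorphic representation $\rho\colon G\to \mathrm{GL}_n(\mathbb C)$ such that the matrix $\rho(u)-I_n$ is nilpotent. Then every unipotent element $u\in G$ is *real*, i.e. there is $h\in G$ with $u^{-1}=huh^{-1}$. -/

import Mathlib

open scoped Manifold ContDiff

/-- An element of a group is real (or reversible) if it is conjugate to its inverse. -/
def IsRealElement {G : Type*} [Group G] (g : G) : Prop :=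
  ∃ h : G, g⁻¹ = h * g * h⁻¹

/-- A homomorphism from a complex Lie group `G` to `GL n ℂ` is a holomorphic representation if all
of its matrix coefficients are complex analytic functions on `G`. -/
def IsHolomorphicRep (E : Type*) [NormedAddCommGroup E] [NormedSpace ℂ E]
    {G : Type*} [Group G] [TopologicalSpace G] [ChartedSpace E G] {n : ℕ}
    (ρ : G →* Matrix.GeneralLinearGroup (Fin n) ℂ) : Prop :=
  ∀ i j : Fin n, ContMDiff 𝓘(ℂ, E) 𝓘(ℂ, ℂ) ω
    fun g : G => (ρ g : Matrix (Fin n) (Fin n) ℂ) i j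

/-- An element `u` of a complex Lie group `G` is unipotent if some faithful finite-dimensional
holomorphic representation of `G` maps it to a unipotent matrix, that is, to a matrix `A` such that
`A - 1` is nilpotent. -/
def IsUnipotentElement (E : Type*) [NormedAddCommGroup E] [NormedSpace ℂ E]
    {G : Type*} [Group G] [TopologicalSpace G] [ChartedSpace E G] (u : G) : Prop :=
  ∃ (n : ℕ) (ρ : G →* Matrix.GeneralLinearGroup (Fin n) ℂ),
    Function.Injective ρ ∧ IsHolomorphicRep E ρ ∧
      IsNilpotent ((ρ u : Matrix (Fin n) (Fin n) ℂ) - 1)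

/-! Write `F u = exp N` with `N` nilpotent, and let `φ` be the derivative of the faithful
representation `F`, an embedding of the Lie algebra `L` into a matrix algebra `A`. The heart of the
proof is that `N` lies in `φ(L)`.

Conjugation by the powers of `F u` preserves `φ(L)` and depends polynomially on the exponent, so
`[N, φ(L)] ⊆ φ(L)`. As there are finitely many components, some power of `u` acts trivially on the
commutant of `φ(L)`; hence `N` commutes with this commutant. Derivations of `L` are inner, so `Z = N
- φ y` lies in the commutant for some `y`. Here `y` is ad-nilpotent, so `⁅h, y⁆ = y` for some `h`,
and `φ y` is nilpotent. Thus `Z` is nilpotent and trace-orthogonal to the commutant, i.e. `Z ∈ [L,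
A]`. A Casimir argument shows that no nonzero invariant lies in `[L, A]`, so `Z = 0`
(`exists_lie_eq_two_smul`).

Now `[φ(2h), N] = 2N`, so `exp((πi/2) φ(2h))` conjugates `N` to `-N`, hence `F u` to its inverse.
This exponential lies in the image of `F` (`exists_eq_exp_repDeriv`), and faithfulness carries the
conjugation back to `G`. -/

/-! ### Casimir endomorphisms and invariants of modules over semisimple Lie algebras. -/

section SemisimpleModules

attribute [local instance 100] LieRing.ofAssociativeRing

namespace LieModule

open LieAlgebra

variable {K L : Type*} [Field K] [LieRing L] [LieAlgebra K L]
  [FiniteDimensional K L] [IsKilling K L]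

/-- The part of a semisimple Lie algebra that acts faithfully on a module: the complement of the
kernel of the action. -/
noncomputable def kerCompl (K L M : Type*) [Field K] [LieRing L] [LieAlgebra K L]
    [AddCommGroup M] [Module K M] [LieRingModule L M] [LieModule K L M] : LieIdeal K L :=
  (LieModule.ker K L M).killingCompl

variable {M : Type*} [AddCommGroup M] [Module K M] [LieRingModule L M] [LieModule K L M]

theorem isCompl_ker_kerCompl : IsCompl (LieModule.ker K L M) (kerCompl K L M) :=
  LieIdeal.isCompl_killingCompl _

theorem eq_zero_of_mem_kerCompl {x : L} (hx : x ∈ kerCompl K L M)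
    (h : ∀ m : M, ⁅x, m⁆ = 0) : x = 0 := by
  have := (isCompl_ker_kerCompl (K := K) (L := L) (M := M)).disjoint.eq_bot
  rw [← LieSubmodule.mem_bot (R := K) (L := L), ← this]
  exact ⟨by simpa [LieModule.mem_ker] using h, hx⟩

/-- The action intertwines `ad x` with the commutator by the endomorphism of `x`, which is
nilpotent, and it is faithful on `kerCompl`. -/
theorem isNilpotent_ad_of_mem_kerCompl {x : L} (hx : x ∈ kerCompl K L M)
    (h : _root_.IsNilpotent (toEnd K L M x)) : _root_.IsNilpotent (ad K L x) := by
  obtain ⟨k, hk⟩ := LieAlgebra.ad_nilpotent_of_nilpotent (R := K) h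
  -- The extra bracket with `x` puts the result into the ideal `kerCompl`, even if `k = 0`.
  refine ⟨k + 1, LinearMap.ext fun y ↦ ?_⟩
  have key : ∀ (j : ℕ) (z : L), toEnd K L M ((ad K L x ^ j) z) =
      (ad K (Module.End K M) (toEnd K L M x) ^ j) (toEnd K L M z) := by
    intro j
    induction j with
    | zero => simp
    | succ j ih =>
      intro z
      rw [pow_succ, pow_succ, Module.End.mul_apply, Module.End.mul_apply, ih]
      simp
  refine eq_zero_of_mem_kerCompl (K := K) (M := M) ?_ fun m ↦ ?_
  · rw [pow_succ', Module.End.mul_apply, ad_apply]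
    exact lie_mem_left K L _ _ _ hx
  · rw [← toEnd_apply_apply K, key, pow_succ', hk, mul_zero]
    rfl

variable [CharZero K] [FiniteDimensional K M]

/-- The trace form of a module is nondegenerate on the part of the Lie algebra that acts
faithfully. -/
theorem eq_zero_of_mem_kerCompl_of_traceForm {x : L} (hx : x ∈ kerCompl K L M)
    (h : ∀ y, traceForm K L M x y = 0) : x = 0 := by
  -- Cartan's criterion: the trace form vanishes on the ideal `I`, so `[I, I]` acts nilpotently on
  -- `M`. It is then ad-nilpotent by faithfulness and nilpotent by Engel, so `I` is solvable and
  -- hence zero.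
  let R : LieIdeal K L := InvariantForm.orthogonal (traceForm K L M)
    (traceForm_lieInvariant K L M) ⊤
  let I : LieIdeal K L := R ⊓ kerCompl K L M
  have hxI : x ∈ I := ⟨(InvariantForm.mem_orthogonal _ _ _ _).2 fun y _ ↦ by
    rw [traceForm_comm]; exact h y, hx⟩
  have htr : traceForm K I M = 0 := by
    ext ⟨y, hy⟩ ⟨z, hz⟩
    exact (InvariantForm.mem_orthogonal _ _ _ _).1 hz.1 y trivial
  have hnil := isNilpotent_derivedSeries_of_traceForm_eq_zero htr
  have hsol : IsSolvable I := by
    set D : LieIdeal K L := ⁅I, I⁆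
    have hD : D ≤ I := LieSubmodule.lie_le_left I I
    have ring_nilp : LieRing.IsNilpotent D := by
      rw [LieAlgebra.isNilpotent_iff_forall (R := K)]
      rintro ⟨y, hy⟩
      apply LieSubalgebra.isNilpotent_ad_of_isNilpotent_ad (D : LieSubalgebra K L) (x := ⟨y, hy⟩)
      refine isNilpotent_ad_of_mem_kerCompl (M := M) (hD hy).2 ?_
      refine (LieModule.isNilpotent_iff_forall' (R := K)).mp hnil ⟨⟨y, hD hy⟩, ?_⟩
      rwa [LieIdeal.derivedSeries_eq_derivedSeriesOfIdeal_comap, LieIdeal.mem_comap]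
    obtain ⟨k, hk⟩ := IsSolvable.solvable K D
    rw [LieIdeal.derivedSeries_eq_bot_iff] at hk
    refine IsSolvable.mk (R := K) (k := k + 1)
      ((LieIdeal.derivedSeries_eq_bot_iff I (k + 1)).mpr ?_)
    rwa [derivedSeriesOfIdeal_add, derivedSeriesOfIdeal_succ, derivedSeriesOfIdeal_zero]
  have := (LieIdeal.solvable_iff_le_radical K L I).1 hsol hxI
  simpa using this

-- These are bases dual for the trace form, from which the Casimir endomorphism is built.
-- Restriction to `kerCompl` is essential: the form degenerates on the kernel of the action.
variable (K L M) in
theorem exists_dual_families :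
    ∃ b b' : Fin (Module.finrank K (kerCompl K L M)) → L,
      (∀ i, b i ∈ kerCompl K L M) ∧ (∀ i, b' i ∈ kerCompl K L M) ∧
      (∀ z ∈ kerCompl K L M, z = ∑ j, traceForm K L M (b' j) z • b j) ∧
      (∀ z ∈ kerCompl K L M, z = ∑ j, traceForm K L M (b j) z • b' j) ∧
      ∀ i, traceForm K L M (b i) (b' i) = 1 := by
  let J := kerCompl K L M
  let B : LinearMap.BilinForm K J := (traceForm K L M).restrict J.toSubmodule
  have hsymm : B.IsSymm := ⟨fun x y ↦ traceForm_comm K L M x y⟩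
  have hB : B.Nondegenerate := by
    refine hsymm.isRefl.nondegenerate_iff_separatingLeft.2 ?_
    intro x hx
    refine Subtype.ext (eq_zero_of_mem_kerCompl_of_traceForm (M := M) x.2 fun y ↦ ?_)
    obtain ⟨k, hk, j, hj, rfl⟩ := (LieSubmodule.mem_sup _ _ _).1
      (((isCompl_ker_kerCompl (K := K) (L := L) (M := M)).sup_eq_top).ge (Set.mem_univ y))
    have h1 : traceForm K L M x k = 0 := by
      have h0 : toEnd K L M k = 0 := LinearMap.ext fun m ↦ (LieModule.mem_ker K L M k).1 hk m
      rw [traceForm_apply_apply, h0]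
      simp
    have h2 : traceForm K L M x j = 0 := hx ⟨j, hj⟩
    simp [h1, h2]
  let b := Module.finBasis K J
  let b' := B.dualBasis hB b
  refine ⟨fun i ↦ b i, fun i ↦ b' i, fun i ↦ (b i).2, fun i ↦ (b' i).2, fun z hz ↦ ?_,
    fun z hz ↦ ?_, fun i ↦ ?_⟩
  · have := congrArg Subtype.val (b.sum_repr ⟨z, hz⟩)
    rw [AddSubmonoidClass.coe_finsetSum] at this
    refine this.symm.trans (Finset.sum_congr rfl fun j _ ↦ ?_)
    have h2 : b.repr ⟨z, hz⟩ j = B (b' j) ⟨z, hz⟩ := by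
      conv_rhs => rw [← b.sum_repr ⟨z, hz⟩, map_sum]
      simp only [map_smul, smul_eq_mul, b', B.apply_dualBasis_left hB]
      simp
    rw [h2]
    rfl
  · have := congrArg Subtype.val (b'.sum_repr ⟨z, hz⟩)
    rw [AddSubmonoidClass.coe_finsetSum] at this
    refine this.symm.trans (Finset.sum_congr rfl fun j _ ↦ ?_)
    rw [B.dualBasis_repr_apply hB b, traceForm_comm]
    rfl
  · exact (B.apply_dualBasis_right hB hsymm b i i).trans (if_pos rfl)

/-- Over a semisimple Lie algebra, a module with nontrivial action has a Casimir endomorphism: it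
commutes with the action, vanishes on the invariants, and is not nilpotent. -/
theorem exists_casimir (h : ¬ IsTrivial L M) :
    ∃ Ω : Module.End K M, (∀ (x : L) (m : M), Ω ⁅x, m⁆ = ⁅x, Ω m⁆) ∧
      (∀ m ∈ maxTrivSubmodule K L M, Ω m = 0) ∧ ¬ _root_.IsNilpotent Ω := by
  obtain ⟨b, b', hb, hb', hz, hz', h1⟩ := exists_dual_families K L M
  refine ⟨∑ i, toEnd K L M (b i) * toEnd K L M (b' i), fun x m ↦ ?_, fun m hm ↦ ?_, fun hn ↦ ?_⟩
  -- Invariance of the trace form: `x` kills the tensor `∑ b i ⊗ b' i`, since its two contributions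
  -- have opposite coefficients.
  · have e1 : ∑ i, ⁅⁅x, b i⁆, ⁅b' i, m⁆⁆ + ∑ i, ⁅b i, ⁅⁅x, b' i⁆, m⁆⁆ = 0 := by
      have l1 : ∀ i, ⁅⁅x, b i⁆, ⁅b' i, m⁆⁆ =
          ∑ j, traceForm K L M (b' j) ⁅x, b i⁆ • ⁅b j, ⁅b' i, m⁆⁆ := fun i ↦ by
        conv_lhs => rw [hz _ (lie_mem_right K L _ _ _ (hb i))]
        simp [sum_lie]
      have l2 : ∀ i, ⁅b i, ⁅⁅x, b' i⁆, m⁆⁆ =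
          ∑ j, traceForm K L M (b j) ⁅x, b' i⁆ • ⁅b i, ⁅b' j, m⁆⁆ := fun i ↦ by
        conv_lhs => rw [hz' _ (lie_mem_right K L _ _ _ (hb' i))]
        simp [lie_sum, sum_lie]
      simp_rw [l1, l2]
      rw [Finset.sum_comm, ← Finset.sum_add_distrib]
      refine Finset.sum_eq_zero fun i _ ↦ ?_
      rw [← Finset.sum_add_distrib]
      refine Finset.sum_eq_zero fun j _ ↦ ?_
      rw [← add_smul, traceForm_comm K L M (b' i), traceForm_apply_lie_apply',
        neg_add_cancel, zero_smul]
    simp only [LinearMap.sum_apply, Module.End.mul_apply, toEnd_apply_apply, lie_sum]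
    rw [← sub_eq_zero, ← Finset.sum_sub_distrib, ← neg_eq_zero, ← Finset.sum_neg_distrib, ← e1,
      ← Finset.sum_add_distrib]
    refine Finset.sum_congr rfl fun i _ ↦ ?_
    simp only [lie_lie, lie_sub]
    abel
  · simp [(mem_maxTrivSubmodule K L M m).1 hm]
  -- The trace of the Casimir endomorphism is the dimension of `kerCompl`, nonzero unless the action
  -- is trivial.
  · have htr := (LinearMap.isNilpotent_trace_of_isNilpotent hn).eq_zero
    have h1' : ∀ i, LinearMap.trace K M (toEnd K L M (b i) * toEnd K L M (b' i)) = 1 := h1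
    simp only [map_sum, h1', Finset.sum_const, Finset.card_univ, Fintype.card_fin, nsmul_eq_mul,
      mul_one, Nat.cast_eq_zero] at htr
    refine h ⟨fun x m ↦ (LieModule.mem_ker K L M x).1 ?_ m⟩
    have hbot : kerCompl K L M = ⊥ :=
      (LieSubmodule.toSubmodule_eq_bot _).1 (Submodule.finrank_eq_zero.1 htr)
    have htop := (isCompl_ker_kerCompl (K := K) (L := L) (M := M)).sup_eq_top
    rw [hbot, sup_bot_eq] at htop
    exact htop.ge (Set.mem_univ x)

/-- For a semisimple Lie algebra, no nonzero invariant of a module is a sum of elements of the form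
`⁅x, m⁆`. -/
theorem eq_zero_of_mem_maxTrivSubmodule_of_mem_lie_top {m : M}
    (hm : m ∈ maxTrivSubmodule K L M) (hm' : m ∈ ⁅(⊤ : LieIdeal K L), (⊤ : LieSubmodule K L M)⁆) :
    m = 0 := by
  induction hd : Module.finrank K M using Nat.strong_induction_on generalizing M with
  | _ d ih =>
  by_cases htriv : IsTrivial L M
  · simpa using hm'
  obtain ⟨Ω, hΩ, hΩm, hnil⟩ := exists_casimir (K := K) htriv
  have hpow : ∀ (k : ℕ) (x : L) (m : M), (Ω ^ k) ⁅x, m⁆ = ⁅x, (Ω ^ k) m⁆ := fun k ↦ by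
    induction k with
    | zero => simp
    | succ k ihk => intro x m; simp [pow_succ', ihk, hΩ]
  -- Fitting decomposition. Induction on the quotient by the range of `Ω ^ k` puts `m` in that
  -- range; `k ≥ 1` puts the invariant `m` in the kernel as well.
  obtain ⟨k, hk, hk1⟩ := (Ω.eventually_disjoint_ker_pow_range_pow.and
    (Filter.eventually_ge_atTop 1)).exists
  let N : LieSubmodule K L M :=
    { LinearMap.range (Ω ^ k) with
      lie_mem := by
        rintro x _ ⟨m, rfl⟩
        exact ⟨⁅x, m⁆, hpow k x m⟩ }
  have hN : N.toSubmodule ≠ ⊥ := fun h0 ↦ hnil ⟨k, LinearMap.range_eq_bot.1 h0⟩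
  have hlt : Module.finrank K (M ⧸ N) < d := by
    have h1 := N.toSubmodule.finrank_quotient_add_finrank
    have h2 : Module.finrank K N.toSubmodule ≠ 0 := fun h0 ↦ hN (Submodule.finrank_eq_zero.1 h0)
    have h3 : Module.finrank K (M ⧸ N) = Module.finrank K (M ⧸ N.toSubmodule) := rfl
    omega
  have hmN : m ∈ N := by
    rw [← LieSubmodule.Quotient.mk_eq_zero]
    refine ih _ hlt ?_ ?_ rfl
    · intro x
      rw [← LieModuleHom.map_lie, (mem_maxTrivSubmodule K L M m).1 hm, map_zero]
    · have := LieSubmodule.mem_map_of_mem (f := LieSubmodule.Quotient.mk' N) hm'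
      rw [LieSubmodule.map_bracket_eq] at this
      exact LieSubmodule.mono_lie_right _ le_top this
  refine (Submodule.disjoint_def.1 hk) m ?_ hmN
  obtain ⟨j, rfl⟩ := Nat.exists_eq_add_of_le' hk1
  rw [LinearMap.mem_ker, pow_succ, Module.End.mul_apply, hΩm m hm, map_zero]

end LieModule
end SemisimpleModules

/-! ### Nilpotent elements normalizing a semisimple Lie algebra of matrices. -/

section NilpotentElements

attribute [local instance 100] LieRing.ofAssociativeRing

open LieAlgebra

/-- In a finite-dimensional algebra of characteristic zero, an eigenvector of an inner derivation
with nonzero eigenvalue is nilpotent. -/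
theorem isNilpotent_of_mul_sub_mul_eq_smul {K A : Type*} [Field K] [CharZero K] [Ring A]
    [Algebra K A] [FiniteDimensional K A] {h y : A} {c : K} (hc : c ≠ 0)
    (hy : h * y - y * h = c • y) : IsNilpotent y := by
  by_contra hn
  -- Nonzero powers of `y` are eigenvectors with the distinct eigenvalues `k * c`, of which there
  -- can be only finitely many.
  have hpow : ∀ k : ℕ, h * y ^ k - y ^ k * h = (k * c : K) • y ^ k := by
    intro k
    induction k with
    | zero => simp
    | succ k ih =>
      have : h * y ^ (k + 1) - y ^ (k + 1) * h =
          (h * y ^ k - y ^ k * h) * y + y ^ k * (h * y - y * h) := by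
        rw [pow_succ]; noncomm_ring
      rw [this, ih, hy, smul_mul_assoc, mul_smul_comm, ← pow_succ, ← add_smul]
      push_cast
      ring_nf
  let f : Module.End K A := LinearMap.mulLeft K h - LinearMap.mulRight K h
  have hev : ∀ k : ℕ, f.HasEigenvalue (k * c) := fun k ↦
    Module.End.hasEigenvalue_of_hasEigenvector (x := y ^ k)
      ⟨Module.End.mem_eigenspace_iff.2 (by simpa [f] using hpow k), fun h0 ↦ hn ⟨k, h0⟩⟩
  refine Set.infinite_of_injective_forall_mem (f := fun k : ℕ ↦ (k * c : K)) ?_ hev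
    f.finite_hasEigenvalue
  intro i j hij
  simpa [hc] using hij

/-- In a semisimple Lie algebra, an ad-nilpotent element `y` has the form `⁅h, y⁆`. -/
theorem exists_lie_eq_self_of_isNilpotent_ad {K L : Type*} [Field K] [LieRing L]
    [LieAlgebra K L] [FiniteDimensional K L] [IsKilling K L] {y : L}
    (hy : IsNilpotent (ad K L y)) : ∃ h : L, ⁅h, y⁆ = y := by
  let B := killingForm K L
  have hB : B.Nondegenerate := IsKilling.killingForm_nondegenerate K L
  have hrefl : B.IsRefl := (LieModule.traceForm_isSymm K L L).isRefl
  -- An element `w` orthogonal to the range of `ad y` centralizes `y`; then `ad y` times `ad w` is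
  -- nilpotent and has trace zero.
  have key : y ∈ B.orthogonal (B.orthogonal (LinearMap.range (ad K L y))) := by
    intro w hw
    have hw' : ⁅y, w⁆ = 0 := by
      refine hB.1 _ fun x ↦ ?_
      have h1 : B (⁅y, x⁆) w = 0 := hw _ ⟨x, rfl⟩
      have h2 : B ⁅y, x⁆ w = - B x ⁅y, w⁆ := LieModule.traceForm_apply_lie_apply' K L L y x w
      rw [h1] at h2
      rw [LieModule.traceForm_comm]
      exact neg_eq_zero.1 h2.symm
    have hcomm : Commute (ad K L w) (ad K L y) := by
      rw [commute_iff_lie_eq, ← LieHom.map_lie, ← lie_skew, hw', neg_zero, map_zero]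
    exact (LinearMap.isNilpotent_trace_of_isNilpotent
      (hcomm.isNilpotent_mul_left hy)).eq_zero
  rw [LinearMap.BilinForm.orthogonal_orthogonal hB hrefl] at key
  obtain ⟨x, hx⟩ := key
  exact ⟨-x, by rw [neg_lie, lie_skew]; exact hx⟩

/-- The commutator with `N` pulls back along `φ` to a derivation, which is inner. -/
theorem exists_ad_of_normalizes {K L A : Type*} [Field K] [LieRing L] [LieAlgebra K L]
    [FiniteDimensional K L] [IsKilling K L] [Ring A] [Algebra K A]
    {φ : L →ₗ⁅K⁆ A} (hinj : Function.Injective φ) {N : A} (hN : ∀ x, ∃ y, φ y = ⁅N, φ x⁆) :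
    ∃ y : L, ∀ x, φ ⁅y, x⁆ = ⁅N, φ x⁆ := by
  choose D hD using hN
  let D' : LieDerivation K L L :=
    { toFun := D
      map_add' := fun x y ↦ hinj (by simp [hD])
      map_smul' := fun c x ↦ hinj (by
        simp only [hD, map_smul, Ring.lie_def, RingHom.id_apply, mul_smul_comm, smul_mul_assoc,
          smul_sub])
      leibniz' := fun x y ↦ hinj (by
        change φ (D _) = φ (⁅x, D y⁆ - ⁅y, D x⁆)
        simp only [hD, map_sub, LieHom.map_lie, Ring.lie_def]
        noncomm_ring) }
  obtain ⟨y, hy⟩ := LieDerivation.IsKilling.exists_eq_ad D'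
  refine ⟨y, fun x ↦ ?_⟩
  rw [← hD]
  have : LieDerivation.ad K L y x = D' x := congrArg (fun d : LieDerivation K L L ↦ d x) hy
  exact congrArg φ ((LieDerivation.ad_apply_apply ..).symm.trans this)

/-- If a nilpotent matrix normalizes the image of a faithful representation of a semisimple Lie
algebra and commutes with the commutant of this image, then it is an eigenvector of eigenvalue `2`
for the adjoint action of some element of the Lie algebra. -/
theorem exists_lie_eq_two_smul {K L : Type*} [Field K] [CharZero K] [LieRing L] [LieAlgebra K L]
    [FiniteDimensional K L] [IsKilling K L] {n : Type*} [Fintype n] [DecidableEq n]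
    {φ : L →ₗ⁅K⁆ Matrix n n K} (hinj : Function.Injective φ) {N : Matrix n n K}
    (hnil : IsNilpotent N) (hN : ∀ x, ∃ y, φ y = ⁅N, φ x⁆)
    (hcomm : ∀ c, (∀ x, Commute (φ x) c) → Commute N c) :
    ∃ h : L, ⁅φ h, N⁆ = (2 : K) • N := by
  obtain ⟨y, hy⟩ := exists_ad_of_normalizes hinj hN
  have hady : IsNilpotent (ad K L y) := by
    obtain ⟨k, hk⟩ := LieAlgebra.ad_nilpotent_of_nilpotent (R := K) hnil
    have key : ∀ (j : ℕ) (z : L), φ ((ad K L y ^ j) z) = (ad K (Matrix n n K) N ^ j) (φ z) := by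
      intro j
      induction j with
      | zero => simp
      | succ j ih =>
        intro z
        rw [pow_succ, pow_succ, Module.End.mul_apply, Module.End.mul_apply, ih, ad_apply, hy,
          ad_apply]
    exact ⟨k, LinearMap.ext fun z ↦ hinj (by rw [key, hk]; simp)⟩
  obtain ⟨h, hh⟩ := exists_lie_eq_self_of_isNilpotent_ad hady
  have hynil : IsNilpotent (φ y) := by
    refine isNilpotent_of_mul_sub_mul_eq_smul (K := K) (h := φ h) (c := 1) one_ne_zero ?_
    rw [← Ring.lie_def, ← LieHom.map_lie, hh, one_smul]
  suffices hZ : N - φ y = 0 by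
    refine ⟨(2 : K) • h, ?_⟩
    rw [sub_eq_zero.1 hZ, ← LieHom.map_lie, smul_lie, hh, map_smul]
  have hZcomm : ∀ x, ⁅φ x, N - φ y⁆ = 0 := fun x ↦ by
    rw [← lie_skew, sub_lie, ← LieHom.map_lie, hy, sub_self, neg_zero]
  have hNy : Commute N (φ y) := by
    have h1 : Commute N (N - φ y) := hcomm _ fun x ↦ commute_iff_lie_eq.2 (hZcomm x)
    simpa using (Commute.refl N).sub_right h1
  have hZnil : IsNilpotent (N - φ y) := hNy.isNilpotent_sub hnil hynil
  let _ : LieRingModule L (Matrix n n K) := LieRingModule.compLieHom _ φ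
  let _ : LieModule K L (Matrix n n K) := LieModule.compLieHom _ φ
  have hlie : ∀ (x : L) (m : Matrix n n K), ⁅x, m⁆ = φ x * m - m * φ x := fun x m ↦ rfl
  refine LieModule.eq_zero_of_mem_maxTrivSubmodule_of_mem_lie_top (K := K) (L := L) hZcomm ?_
  let B : LinearMap.BilinForm K (Matrix n n K) :=
    (LinearMap.mul K (Matrix n n K)).compr₂ (Matrix.traceLinearMap n K K)
  have hBapp : ∀ a b, B a b = (a * b).trace := fun a b ↦ rfl
  have hsymm : B.IsSymm := ⟨fun a b ↦ Matrix.trace_mul_comm a b⟩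
  have hsep : ∀ a, (∀ b, B a b = 0) → a = 0 := fun a ha ↦ by
    ext i j
    simpa [hBapp, Matrix.trace_mul_single] using ha (Matrix.single j i 1)
  have hB : B.Nondegenerate := hsymm.isRefl.nondegenerate_iff_separatingLeft.2 hsep
  let W : LieSubmodule K L (Matrix n n K) := ⁅(⊤ : LieIdeal K L), (⊤ : LieSubmodule K L _)⁆
  -- The trace-orthogonal of `[L, A]` is the commutant of `φ(L)`, and `N - φ y` is orthogonal to it
  -- because its product with a commuting `c` is nilpotent.
  have key : N - φ y ∈ B.orthogonal (B.orthogonal W.toSubmodule) := by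
    intro c hc
    have hcφ : ∀ x, Commute (φ x) c := fun x ↦ by
      refine sub_eq_zero.1 (hsep _ fun b ↦ ?_)
      have h1 : B ⁅x, b⁆ c = 0 :=
        hc _ (LieSubmodule.lie_mem_lie (LieSubmodule.mem_top x) (LieSubmodule.mem_top b))
      rw [hlie, hBapp, sub_mul, Matrix.trace_sub, Matrix.trace_mul_cycle, mul_assoc b,
        Matrix.trace_mul_comm b, ← Matrix.trace_sub, ← sub_mul, ← neg_sub, neg_mul,
        Matrix.trace_neg, neg_eq_zero] at h1
      exact h1
    have hcZ : Commute c (N - φ y) := (hcomm c hcφ).symm.sub_right (hcφ y).symm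
    exact (Matrix.isNilpotent_trace_of_isNilpotent (hcZ.isNilpotent_mul_left hZnil)).eq_zero
  rwa [LinearMap.BilinForm.orthogonal_orthogonal hB hsymm.isRefl] at key

end NilpotentElements

/-! ### Logarithms of unipotent elements and polynomial one-parameter groups. -/

section UnipotentElements

open Polynomial in
/-- If `exp (m • N) * x * exp (-(m • N))` is congruent to `x` modulo a subspace for all natural
numbers `m`, then so is the commutator `N * x - x * N` to zero. -/
theorem mul_sub_mul_mem_of_exp_conj_sub_mem {K A : Type*} [Field K] [CharZero K] [Ring A]
    [Algebra K A] [Algebra ℚ A] {N : A} (hN : IsNilpotent N) (W : Submodule K A) {x : A}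
    (h : ∀ m : ℕ, IsNilpotent.exp (m • N) * x * IsNilpotent.exp (-(m • N)) - x ∈ W) :
    N * x - x * N ∈ W := by
  by_contra hne
  obtain ⟨f, hf, hfW⟩ := W.exists_dual_map_eq_bot_of_notMem hne inferInstance
  have hW : ∀ w ∈ W, f w = 0 := fun w hw ↦ by
    have : f w ∈ W.map f := ⟨w, hw, rfl⟩
    simpa [hfW] using this
  obtain ⟨k, hk⟩ := hN
  have hk2 : N ^ (k + 2) = 0 := by rw [pow_add, hk, zero_mul]
  -- As a polynomial in `m`, the conjugate of `x` under `f` has linear coefficient `f (N * x - x *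
  -- N)`. The range `k + 2` guarantees that the terms of degree `1` occur even if `k = 0`.
  let p : K[X] := ∑ i ∈ Finset.range (k + 2), ∑ j ∈ Finset.range (k + 2),
    monomial (i + j) (((i.factorial : ℚ)⁻¹ * (j.factorial : ℚ)⁻¹ * (-1) ^ j : ℚ) *
      f (N ^ i * x * N ^ j))
  have hp : ∀ m : ℕ, p.eval (m : K) =
      f (IsNilpotent.exp (m • N) * x * IsNilpotent.exp (-(m • N))) := fun m ↦ by
    have h1 : (m • N) ^ (k + 2) = 0 := by rw [_root_.smul_pow, hk2, smul_zero]
    have h2 : (-(m • N)) ^ (k + 2) = 0 := by rw [neg_pow, h1, mul_zero]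
    rw [IsNilpotent.exp_eq_sum h1, IsNilpotent.exp_eq_sum h2, eval_finsetSum, Finset.sum_mul,
      Finset.sum_mul, map_sum]
    refine Finset.sum_congr rfl fun i _ ↦ ?_
    rw [eval_finsetSum, Finset.mul_sum, map_sum]
    refine Finset.sum_congr rfl fun j _ ↦ ?_
    have h3 : (i.factorial : ℚ)⁻¹ • (m • N) ^ i * x * (j.factorial : ℚ)⁻¹ • (-(m • N)) ^ j =
        ((i.factorial : ℚ)⁻¹ * (j.factorial : ℚ)⁻¹ * (-1) ^ j * (m : ℚ) ^ (i + j)) •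
          (N ^ i * x * N ^ j) := by
      have h4 : m • N = (m : ℚ) • N := (Nat.cast_smul_eq_nsmul ℚ m N).symm
      have h5 : -(m • N) = (-(m : ℚ)) • N := by rw [h4, neg_smul]
      rw [h5, h4, _root_.smul_pow, _root_.smul_pow]
      simp only [smul_mul_assoc, mul_smul_comm, smul_smul]
      congr 1
      rw [neg_pow]
      ring
    rw [h3, map_rat_smul, eval_monomial, Rat.smul_def]
    push_cast
    ring
  have hp0 : p = C (f x) := by
    rw [← sub_eq_zero]
    refine eq_zero_of_infinite_isRoot _ ((Set.infinite_range_of_injective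
      (Nat.cast_injective (R := K))).mono ?_)
    rintro _ ⟨m, rfl⟩
    have := hW _ (h m)
    rw [map_sub, ← hp] at this
    simpa [IsRoot] using this
  have hcoeff : p.coeff 1 = (C (f x)).coeff 1 := by rw [hp0]
  refine hf ?_
  simp only [p, finsetSum_coeff, coeff_monomial] at hcoeff
  simp only [Finset.sum_range_succ' _ (k + 1), Finset.sum_range_succ' _ k, coeff_C] at hcoeff
  have hne1 : ∀ i j : ℕ, ¬ i + 1 + 1 + (j + 1 + 1) = 1 := by omega
  simp [hne1] at hcoeff
  rw [map_sub, sub_eq_add_neg, hcoeff]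

theorem IsNilpotent.exp_nsmul {A : Type*} [Ring A] [Algebra ℚ A] {a : A}
    (ha : IsNilpotent a) (m : ℕ) : IsNilpotent.exp (m • a) = IsNilpotent.exp a ^ m := by
  induction m with
  | zero => simp
  | succ m ih =>
    rw [succ_nsmul, exp_add_of_commute ((Commute.refl a).smul_left m) (ha.smul m) ha, ih,
      _root_.pow_succ]

/-- Successive approximation: `exp (-y) * (1 + y)` is `1` plus a multiple of `y ^ 2`, whose
nilpotency order is smaller since `2 * (m - 1) ≥ m` for `m ≥ 2`. -/
theorem IsNilpotent.exists_exp_eq_one_add_aux {A : Type*} [CommRing A] [Algebra ℚ A] (m : ℕ) :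
    ∀ y : A, y ^ m = 0 → ∃ x : A, IsNilpotent x ∧ IsNilpotent.exp x = 1 + y := by
  induction m using Nat.strong_induction_on with
  | _ m ih =>
  intro y hy
  obtain hm | hm := lt_or_ge m 2
  · have hy0 : y = 0 := by
      have : y ^ 1 = 0 := pow_eq_zero_of_le (by omega) hy
      simpa using this
    exact ⟨0, .zero, by simp [hy0]⟩
  have hynil : IsNilpotent y := ⟨m, hy⟩
  obtain ⟨s, hs⟩ : ∃ s : A, IsNilpotent.exp (-y) = 1 - y + y ^ 2 * s := by
    have h2 : (-y) ^ (m + 2) = 0 := pow_eq_zero_of_le (Nat.le_add_right m 2)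
      (by rw [neg_pow, hy, mul_zero])
    refine ⟨∑ i ∈ Finset.range m, ((i + 1 + 1).factorial : ℚ)⁻¹ • (-y) ^ i, ?_⟩
    rw [IsNilpotent.exp_eq_sum h2, Finset.sum_range_succ', Finset.sum_range_succ', Finset.mul_sum]
    have : ∀ i, ((i + 1 + 1).factorial : ℚ)⁻¹ • (-y) ^ (i + 1 + 1) =
        y ^ 2 * (((i + 1 + 1).factorial : ℚ)⁻¹ • (-y) ^ i) := fun i ↦ by
      rw [mul_smul_comm]; congr 1; ring
    simp only [this]
    simp
    ring
  obtain ⟨x, hx, hxe⟩ := ih (m - 1) (by omega) (y ^ 2 * (s + y * s - 1)) (by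
    rw [mul_pow, ← pow_mul, pow_eq_zero_of_le (by omega) hy, zero_mul])
  refine ⟨y + x, (Commute.all _ _).isNilpotent_add hynil hx, ?_⟩
  rw [exp_add_of_commute (Commute.all _ _) hynil hx, hxe]
  have h1 : 1 + y ^ 2 * (s + y * s - 1) = IsNilpotent.exp (-y) * (1 + y) := by rw [hs]; ring
  rw [h1, ← mul_assoc, exp_mul_exp_neg_self hynil, one_mul]

/-- Every unipotent element is the exponential of a nilpotent element. -/
theorem IsNilpotent.exists_exp_eq {A : Type*} [Ring A] [Algebra ℚ A] {u : A}
    (hu : IsNilpotent (u - 1)) : ∃ x : A, IsNilpotent x ∧ IsNilpotent.exp x = u := by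
  obtain ⟨m, hm⟩ := hu
  let S := Algebra.adjoin ℚ {u - 1}
  have : IsMulCommutative S := Algebra.isMulCommutative_adjoin ℚ (by simp)
  let y : S := ⟨u - 1, Algebra.self_mem_adjoin_singleton ℚ _⟩
  obtain ⟨x, hx, hxe⟩ := exists_exp_eq_one_add_aux m y (Subtype.ext hm)
  refine ⟨x, hx.map S.val, ?_⟩
  have := congrArg S.val hxe
  rw [map_exp hx] at this
  simpa [y] using this

end UnipotentElements

/-! ### The derivative of a representation as a Lie algebra homomorphism. -/

section LieGroupRepresentations

open Set Filter Topology VectorField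

variable {E : Type*} [NormedAddCommGroup E] [NormedSpace ℂ E]
  {G : Type*} [Group G] [TopologicalSpace G] [ChartedSpace E G]
  {A : Type*} [NormedRing A] [NormedAlgebra ℂ A] {F : G →* A}

/-- The derivative at the identity of a map from a complex Lie group to a Banach algebra. -/
noncomputable def repDeriv (F : G → A) : GroupLieAlgebra 𝓘(ℂ, E) G →L[ℂ] A :=
  mfderiv 𝓘(ℂ, E) 𝓘(ℂ, A) F 1

/-- A left-invariant vector field read in the chart at the identity. -/
noncomputable def chartField (X : GroupLieAlgebra 𝓘(ℂ, E) G) : E → E :=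
  mpullbackWithin 𝓘(ℂ, E) 𝓘(ℂ, E) (extChartAt 𝓘(ℂ, E) (1 : G)).symm (mulInvariantVectorField X)
    (range 𝓘(ℂ, E))

variable [LieGroup 𝓘(ℂ, E) ω G]

theorem mfderiv_mulInvariantVectorField (hF : ContMDiff 𝓘(ℂ, E) 𝓘(ℂ, A) ω F)
    (X : GroupLieAlgebra 𝓘(ℂ, E) G) (g : G) :
    (mfderiv 𝓘(ℂ, E) 𝓘(ℂ, A) F g (mulInvariantVectorField X g) : A) = F g * repDeriv F X := by
  have hd : ∀ g, MDifferentiableAt 𝓘(ℂ, E) 𝓘(ℂ, A) F g := fun g ↦ hF.mdifferentiable (by simp) g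
  have hm : MDifferentiableAt 𝓘(ℂ, E) 𝓘(ℂ, E) (g * ·) (1 : G) :=
    (contMDiff_mul_left (I := 𝓘(ℂ, E)) (n := ω) (a := g)).mdifferentiable (by simp) 1
  have h1 : mfderiv 𝓘(ℂ, E) 𝓘(ℂ, A) (F ∘ (g * ·)) 1 =
      (mfderiv 𝓘(ℂ, E) 𝓘(ℂ, A) F (g * 1)).comp (mfderiv 𝓘(ℂ, E) 𝓘(ℂ, E) (g * ·) (1 : G)) :=
    mfderiv_comp (1 : G) (hd _) hm
  have h2 : F ∘ (g * ·) = (ContinuousLinearMap.mul ℂ A (F g)) ∘ F := by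
    ext x; simp
  have h3 : mfderiv 𝓘(ℂ, E) 𝓘(ℂ, A) ((ContinuousLinearMap.mul ℂ A (F g)) ∘ F) 1 =
      (ContinuousLinearMap.mul ℂ A (F g)).comp (mfderiv 𝓘(ℂ, E) 𝓘(ℂ, A) F 1) := by
    rw [mfderiv_comp (I' := 𝓘(ℂ, A)) (1 : G)
      (ContinuousLinearMap.mul ℂ A (F g)).differentiableAt.mdifferentiableAt (hd 1)]
    rw [ContinuousLinearMap.mfderiv_eq]
    rfl
  rw [h2, h3] at h1
  have := congrArg (fun T : E →L[ℂ] A ↦ T X) h1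
  rw [mul_one] at this
  exact this.symm

/-- The chart form of the equation `dF(X) = F * repDeriv F X`; both the bracket formula and the
integral curves rest on it. -/
theorem fderiv_comp_extChartAt_symm (hF : ContMDiff 𝓘(ℂ, E) 𝓘(ℂ, A) ω F)
    (X : GroupLieAlgebra 𝓘(ℂ, E) G) {y : E} (hy : y ∈ (extChartAt 𝓘(ℂ, E) (1 : G)).target) :
    fderiv ℂ (F ∘ (extChartAt 𝓘(ℂ, E) (1 : G)).symm) y (chartField X y) =
      F ((extChartAt 𝓘(ℂ, E) (1 : G)).symm y) * repDeriv F X := by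
  have hd : ∀ g, MDifferentiableAt 𝓘(ℂ, E) 𝓘(ℂ, A) F g := fun g ↦ hF.mdifferentiable (by simp) g
  have hinv := isInvertible_mfderivWithin_extChartAt_symm (I := 𝓘(ℂ, E)) hy
  have hs : MDifferentiableAt 𝓘(ℂ, E) 𝓘(ℂ, E) (extChartAt 𝓘(ℂ, E) (1 : G)).symm y := by
    rw [← mdifferentiableWithinAt_univ, ← 𝓘(ℂ, E).range_eq_univ]
    exact mdifferentiableWithinAt_of_isInvertible_mfderivWithin hinv
  have h1 := mfderiv_comp (I' := 𝓘(ℂ, E)) y (hd _) hs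
  rw [mfderiv_eq_fderiv] at h1
  rw [h1, ← mfderiv_mulInvariantVectorField hF]
  change mfderiv 𝓘(ℂ, E) 𝓘(ℂ, A) F _ (mfderiv 𝓘(ℂ, E) 𝓘(ℂ, E) (extChartAt 𝓘(ℂ, E) (1 : G)).symm y
    (chartField X y : E)) = _
  congr 1
  rw [chartField, mpullbackWithin_apply]
  rw [← mfderivWithin_univ, ← 𝓘(ℂ, E).range_eq_univ]
  have aux : ∀ T : E →L[ℂ] E, T.IsInvertible → ∀ v, T (T.inverse v) = v :=
    fun T hT v ↦ hT.self_apply_inverse v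
  exact aux _ hinv _

theorem contDiffAt_chartField [CompleteSpace E] (X : GroupLieAlgebra 𝓘(ℂ, E) G) :
    ContDiffAt ℂ 2 (chartField X) (extChartAt 𝓘(ℂ, E) (1 : G) 1) := by
  have : IsManifold 𝓘(ℂ, E) ω G := inferInstance
  have hV : ContMDiffWithinAt 𝓘(ℂ, E) 𝓘(ℂ, E).tangent 2
      (fun g : G ↦ (mulInvariantVectorField X g : TangentBundle 𝓘(ℂ, E) G)) univ
      ((extChartAt 𝓘(ℂ, E) (1 : G)).symm (extChartAt 𝓘(ℂ, E) (1 : G) 1)) := by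
    rw [extChartAt_to_inv, contMDiffWithinAt_univ]
    exact (contMDiff_mulInvariantVectorField (I := 𝓘(ℂ, E)) (G := G) X).contMDiffAt.of_le
      le_minSmoothness
  have h : ContDiffWithinAt ℂ 2 (chartField X) (range 𝓘(ℂ, E))
      (extChartAt 𝓘(ℂ, E) (1 : G) 1) :=
    contMDiffWithinAt_vectorSpace_iff_contDiffWithinAt.1
      (ContMDiffWithinAt.mpullbackWithin_vectorField (n := ω) hV
        (contMDiffWithinAt_extChartAt_symm_range _ (mem_extChartAt_target _))
        (isInvertible_mfderivWithin_extChartAt_symm (mem_extChartAt_target _)) (mem_range_self _)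
        𝓘(ℂ, E).uniqueMDiffOn le_top (mapsTo_univ _ _))
  rwa [𝓘(ℂ, E).range_eq_univ, contDiffWithinAt_univ] at h

theorem repDeriv_lie [CompleteSpace E] (hF : ContMDiff 𝓘(ℂ, E) 𝓘(ℂ, A) ω F)
    (X Y : GroupLieAlgebra 𝓘(ℂ, E) G) :
    repDeriv F ⁅X, Y⁆ = repDeriv F X * repDeriv F Y - repDeriv F Y * repDeriv F X := by
  set φ := extChartAt 𝓘(ℂ, E) (1 : G) with hφ
  set Φ : E → A := F ∘ φ.symm with hΦ
  have hT : φ.target ∈ 𝓝 (φ 1) := extChartAt_target_mem_nhds _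
  have hΦd : ContDiffAt ℂ 2 Φ (φ 1) := by
    rw [← contMDiffAt_iff_contDiffAt]
    refine (hF.of_le le_top).contMDiffAt.comp _ ?_
    exact ((contMDiffOn_extChartAt_symm (n := 2) (1 : G)).contMDiffAt hT)
  have hX := (contDiffAt_chartField X).differentiableAt two_ne_zero
  have hY := (contDiffAt_chartField Y).differentiableAt two_ne_zero
  have hΦ1 : DifferentiableAt ℂ Φ (φ 1) := hΦd.differentiableAt two_ne_zero
  have hΦ2 : DifferentiableAt ℂ (fderiv ℂ Φ) (φ 1) :=
    (hΦd.fderiv_right (m := 1) (by norm_num)).differentiableAt one_ne_zero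
  have hone : Φ (φ 1) = 1 := by simp [hΦ, hφ]
  -- Differentiate the chart equation in the direction `v`. Subtracting its instances for `X` and
  -- `Y` cancels the symmetric second derivative and leaves the bracket.
  have key : ∀ Z : GroupLieAlgebra 𝓘(ℂ, E) G, DifferentiableAt ℂ (chartField Z) (φ 1) → ∀ v,
      fderiv ℂ (fderiv ℂ Φ) (φ 1) v (chartField Z (φ 1)) +
        fderiv ℂ Φ (φ 1) (fderiv ℂ (chartField Z) (φ 1) v) =
      fderiv ℂ Φ (φ 1) v * repDeriv F Z := by
    intro Z hZ v
    have e1 : (fun y ↦ fderiv ℂ Φ y (chartField Z y)) =ᶠ[𝓝 (φ 1)] fun y ↦ Φ y * repDeriv F Z := by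
      filter_upwards [hT] with y hy using fderiv_comp_extChartAt_symm hF Z hy
    have e2 := congrArg (fun T : E →L[ℂ] A ↦ T v) e1.fderiv_eq
    rw [fderiv_clm_apply hΦ2 hZ, fderiv_mul_const' hΦ1] at e2
    simp at e2
    rw [← e2, add_comm]
  have h0 : ∀ Z, fderiv ℂ Φ (φ 1) (chartField Z (φ 1)) = repDeriv F Z := fun Z ↦ by
    rw [fderiv_comp_extChartAt_symm hF Z (mem_extChartAt_target _)]
    simp
  have kX := key X hX (chartField Y (φ 1))
  have kY := key Y hY (chartField X (φ 1))
  have hsymm := hΦd.isSymmSndFDerivAt (by simp) (chartField X (φ 1)) (chartField Y (φ 1))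
  rw [h0] at kX kY
  have hbr : repDeriv F ⁅X, Y⁆ = fderiv ℂ Φ (φ 1) (fderiv ℂ (chartField Y) (φ 1)
      (chartField X (φ 1)) - fderiv ℂ (chartField X) (φ 1) (chartField Y (φ 1))) := by
    have hinv : (mfderiv 𝓘(ℂ, E) 𝓘(ℂ, E) φ 1).IsInvertible :=
      isInvertible_mfderiv_extChartAt (mem_extChartAt_source _)
    have hchain : ∀ v : E, mfderiv 𝓘(ℂ, E) 𝓘(ℂ, A) F 1 v =
        fderiv ℂ Φ (φ 1) (mfderiv 𝓘(ℂ, E) 𝓘(ℂ, E) φ 1 v) := fun v ↦ by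
      have e1 : F =ᶠ[𝓝 1] Φ ∘ φ := by
        filter_upwards [extChartAt_source_mem_nhds (I := 𝓘(ℂ, E)) (1 : G)] with g hg
        rw [hΦ, Function.comp_apply, Function.comp_apply, hφ,
          (extChartAt 𝓘(ℂ, E) (1 : G)).left_inv hg]
      rw [e1.mfderiv_eq, mfderiv_comp (I' := 𝓘(ℂ, E)) (1 : G) hΦ1.mdifferentiableAt
        (mdifferentiableAt_of_isInvertible_mfderiv hinv), mfderiv_eq_fderiv]
      rfl
    have aux : ∀ T : E →L[ℂ] E, T.IsInvertible → ∀ v, T (T.inverse v) = v :=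
      fun T hT v ↦ hT.self_apply_inverse v
    rw [GroupLieAlgebra.bracket_def, ← mlieBracketWithin_univ, mlieBracketWithin_apply]
    refine (hchain _).trans ?_
    congr 1
    refine (aux _ hinv _).trans ?_
    change lieBracketWithin ℂ (chartField X) (chartField Y) _ _ = _
    rw [preimage_univ, univ_inter, 𝓘(ℂ, E).range_eq_univ, lieBracketWithin_univ]
    rfl
  rw [hbr, map_sub, ← kX, ← kY, hsymm]
  abel

end LieGroupRepresentations

/-! ### Integral curves and exponentials in the image of a representation. -/

section LieGroupExponential

open Set Filter Topology VectorField

variable {E : Type*} [NormedAddCommGroup E] [NormedSpace ℂ E] [CompleteSpace E]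
  {G : Type*} [Group G] [TopologicalSpace G] [ChartedSpace E G] [LieGroup 𝓘(ℂ, E) ω G]
  {A : Type*} [NormedRing A] [NormedAlgebra ℂ A] [CompleteSpace A] {F : G →* A}

/-- Left-invariant vector fields have local integral curves through the identity, and a
representation maps them to exponential curves. -/
theorem exists_integralCurve (hF : ContMDiff 𝓘(ℂ, E) 𝓘(ℂ, A) ω F)
    (X : GroupLieAlgebra 𝓘(ℂ, E) G) :
    ∃ α : ℝ → E, α 0 = extChartAt 𝓘(ℂ, E) (1 : G) 1 ∧
      (∀ᶠ t in 𝓝 0, α t ∈ (extChartAt 𝓘(ℂ, E) (1 : G)).target) ∧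
      HasDerivAt α (chartField X (extChartAt 𝓘(ℂ, E) (1 : G) 1)) 0 ∧
      ∀ᶠ t : ℝ in 𝓝 0, F ((extChartAt 𝓘(ℂ, E) (1 : G)).symm (α t)) =
        NormedSpace.exp (t • repDeriv F X) := by
  set φ := extChartAt 𝓘(ℂ, E) (1 : G) with hφ
  have hc : ContDiffAt ℝ 1 (chartField X) (φ 1) :=
    ((contDiffAt_chartField X).restrict_scalars ℝ).of_le (by norm_num)
  obtain ⟨α, h0, ε, hε, hα⟩ :=
    hc.exists_forall_mem_closedBall_exists_eq_forall_mem_Ioo_hasDerivAt₀ 0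
  have hα0 := hα 0 (by simpa using hε)
  rw [h0] at hα0
  have hT : φ.target ∈ 𝓝 (φ 1) := extChartAt_target_mem_nhds _
  have hev : ∀ᶠ t in 𝓝 0, α t ∈ φ.target :=
    hα0.continuousAt.eventually (by rwa [h0])
  refine ⟨α, h0, hev, hα0, ?_⟩
  set Φ : E → A := F ∘ φ.symm with hΦ
  have hIoo : Ioo (0 - ε) (0 + ε) ∈ 𝓝 (0 : ℝ) := Ioo_mem_nhds (by linarith) (by linarith)
  obtain ⟨δ, hδ, hball⟩ := Metric.eventually_nhds_iff_ball.1 (hev.and hIoo)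
  -- Uniqueness for the linear equation: multiplying by the inverse exponential gives a constant.
  have hder : ∀ t ∈ Metric.ball (0 : ℝ) δ,
      HasDerivAt (fun t ↦ Φ (α t) * NormedSpace.exp ((-t) • repDeriv F X)) 0 t := by
    intro t ht
    obtain ⟨ht1, ht2⟩ := hball t ht
    have hΦd : DifferentiableAt ℂ Φ (α t) := by
      have hcd : ContMDiffAt 𝓘(ℂ, E) 𝓘(ℂ, A) 2 Φ (α t) := by
        refine (hF.of_le le_top).contMDiffAt.comp _ ?_
        exact (contMDiffOn_extChartAt_symm (n := 2) (1 : G)).contMDiffAt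
          ((isOpen_extChartAt_target (1 : G)).mem_nhds ht1)
      exact hcd.contDiffAt.differentiableAt two_ne_zero
    have h1 : HasDerivAt (fun t ↦ Φ (α t)) (Φ (α t) * repDeriv F X) t := by
      have := (hΦd.hasFDerivAt.restrictScalars ℝ).comp_hasDerivAt t (hα t ht2)
      rw [ContinuousLinearMap.coe_restrictScalars', fderiv_comp_extChartAt_symm hF X ht1] at this
      exact this
    have h2 : HasDerivAt (fun t : ℝ ↦ NormedSpace.exp ((-t) • repDeriv F X))
        (-(repDeriv F X * NormedSpace.exp ((-t) • repDeriv F X))) t := by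
      have := (hasDerivAt_exp_smul_const' (𝕂 := ℝ) (repDeriv F X) (-t)).scomp t
        (hasDerivAt_neg t)
      rwa [neg_one_smul] at this
    have h3 := h1.mul h2
    rwa [mul_neg, mul_assoc, add_neg_cancel] at h3
  have hconst : ∀ t ∈ Metric.ball (0 : ℝ) δ,
      Φ (α t) * NormedSpace.exp ((-t) • repDeriv F X) = 1 := by
    intro t ht
    have := (convex_ball (0 : ℝ) δ).is_const_of_fderivWithin_eq_zero (𝕜 := ℝ)
      (f := fun t ↦ Φ (α t) * NormedSpace.exp ((-t) • repDeriv F X))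
      (fun s hs ↦ (hder s hs).differentiableAt.differentiableWithinAt) (fun s hs ↦ by
        rw [fderivWithin_of_isOpen Metric.isOpen_ball hs]
        ext
        simpa using! (hder s hs).deriv) ht (Metric.mem_ball_self hδ)
    rw [this]
    simp [h0, hΦ, hφ]
  filter_upwards [Metric.ball_mem_nhds 0 hδ] with t ht
  have h1 : NormedSpace.exp ((-t) • repDeriv F X) * NormedSpace.exp (t • repDeriv F X) = 1 := by
    let _ : NormedAlgebra ℚ A := NormedAlgebra.restrictScalars ℚ ℂ A
    rw [← NormedSpace.exp_add_of_commute (((Commute.refl _).smul_left _).smul_right _), neg_smul,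
      neg_add_cancel, NormedSpace.exp_zero]
  rw [← one_mul (NormedSpace.exp (t • repDeriv F X)), ← hconst t ht, mul_assoc, h1, mul_one]
  rfl

/-- The exponential of an element in the image of the derivative of a representation lies in the
image of the representation. -/
theorem exists_eq_exp_repDeriv (hF : ContMDiff 𝓘(ℂ, E) 𝓘(ℂ, A) ω F)
    (X : GroupLieAlgebra 𝓘(ℂ, E) G) : ∃ g : G, F g = NormedSpace.exp (repDeriv F X) := by
  obtain ⟨α, -, -, -, h⟩ := exists_integralCurve hF X
  have hlim : Tendsto (fun m : ℕ ↦ ((m : ℝ) + 1)⁻¹) atTop (𝓝 0) := by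
    simpa using! tendsto_one_div_add_atTop_nhds_zero_nat (𝕜 := ℝ)
  obtain ⟨m, hm⟩ := (hlim.eventually h).exists
  -- The curve exists only for small times, so the point at time `1 / (m + 1)` is raised to the
  -- power `m + 1`.
  refine ⟨((extChartAt 𝓘(ℂ, E) (1 : G)).symm (α ((m : ℝ) + 1)⁻¹)) ^ (m + 1), ?_⟩
  let _ : NormedAlgebra ℚ A := NormedAlgebra.restrictScalars ℚ ℂ A
  rw [map_pow, hm, ← NormedSpace.exp_nsmul, ← Nat.cast_smul_eq_nsmul ℝ, smul_smul]
  have : (m : ℝ) + 1 ≠ 0 := by positivity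
  rw [Nat.cast_add, Nat.cast_one, mul_inv_cancel₀ this, one_smul]

/-- If the derivative kills `X`, then `F` is constant along the integral curve of `X`; by
faithfulness the curve is constant, so its velocity vanishes. -/
theorem repDeriv_injective (hF : ContMDiff 𝓘(ℂ, E) 𝓘(ℂ, A) ω F) (hinj : Function.Injective F) :
    Function.Injective (repDeriv (E := E) F) := by
  rw [injective_iff_map_eq_zero]
  intro X hX
  obtain ⟨α, h0, hev, hd, h⟩ := exists_integralCurve hF X
  set φ := extChartAt 𝓘(ℂ, E) (1 : G) with hφ
  have hconst : α =ᶠ[𝓝 0] fun _ ↦ φ 1 := by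
    filter_upwards [h, hev] with t ht ht'
    rw [hX, smul_zero, NormedSpace.exp_zero, ← map_one F] at ht
    rw [← hinj ht, φ.right_inv ht']
  have h1 : chartField X (φ 1) = 0 :=
    hd.unique ((hasDerivAt_const (0 : ℝ) (φ 1)).congr_of_eventuallyEq hconst)
  have hinv := isInvertible_mfderivWithin_extChartAt_symm (I := 𝓘(ℂ, E))
    (mem_extChartAt_target (I := 𝓘(ℂ, E)) (1 : G))
  have aux : ∀ T : E →L[ℂ] E, T.IsInvertible → ∀ v, T.inverse v = 0 → v = 0 :=
    fun T hT v hv ↦ by rw [← hT.self_apply_inverse v, hv, map_zero]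
  have h2 : mulInvariantVectorField X (φ.symm (φ 1)) = 0 := aux _ hinv _ h1
  rw [hφ, extChartAt_to_inv] at h2
  have h3 : mulInvariantVectorField X (1 : G) = X := by
    have : (fun x : G ↦ 1 * x) = id := funext one_mul
    rw [mulInvariantVectorField, this, mfderiv_id]
    rfl
  exact h3.symm.trans h2

end LieGroupExponential

/-! ### Conjugation by the group and the role of finitely many components. -/

section ComponentGroup

open Set Filter Topology

variable {E : Type*} [NormedAddCommGroup E] [NormedSpace ℂ E]
  {G : Type*} [Group G] [TopologicalSpace G] [ChartedSpace E G] [LieGroup 𝓘(ℂ, E) ω G]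
  {A : Type*} [NormedRing A] [NormedAlgebra ℂ A] {F : G →* A}

/-- The image of the derivative of a representation is stable under conjugation by the image of
the representation. -/
theorem exists_repDeriv_eq_conj (hF : ContMDiff 𝓘(ℂ, E) 𝓘(ℂ, A) ω F) (g : G)
    (X : GroupLieAlgebra 𝓘(ℂ, E) G) :
    ∃ Y : GroupLieAlgebra 𝓘(ℂ, E) G, repDeriv F Y = F g * repDeriv F X * F g⁻¹ := by
  have hd : ∀ g, MDifferentiableAt 𝓘(ℂ, E) 𝓘(ℂ, A) F g := fun g ↦ hF.mdifferentiable (by simp) g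
  let c : G → G := fun k ↦ g * k * g⁻¹
  have hc : ContMDiff 𝓘(ℂ, E) 𝓘(ℂ, E) ω c :=
    (contMDiff_mul_right (a := g⁻¹)).comp contMDiff_mul_left
  have hc1 : c 1 = 1 := by simp [c]
  let T : A →L[ℂ] A :=
    (ContinuousLinearMap.mul ℂ A (F g)).comp ((ContinuousLinearMap.mul ℂ A).flip (F g⁻¹))
  have hFc : F ∘ c = T ∘ F := by
    ext k; simp [c, T, mul_assoc]
  have h1 : HasMFDerivAt 𝓘(ℂ, E) 𝓘(ℂ, A) (F ∘ c) 1
      ((mfderiv 𝓘(ℂ, E) 𝓘(ℂ, A) F (c 1)).comp (mfderiv 𝓘(ℂ, E) 𝓘(ℂ, E) c 1)) :=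
    (hd _).hasMFDerivAt.comp (1 : G) ((hc.mdifferentiable (by simp)) 1).hasMFDerivAt
  have h2 : HasMFDerivAt 𝓘(ℂ, E) 𝓘(ℂ, A) (T ∘ F) 1
      (T.comp (mfderiv 𝓘(ℂ, E) 𝓘(ℂ, A) F 1)) :=
    (T.hasMFDerivAt (x := F 1)).comp (1 : G) (hd 1).hasMFDerivAt
  rw [← hFc] at h2
  have h3 := congrArg (fun S : E →L[ℂ] A ↦ S X) (hasMFDerivAt_unique h1 h2)
  rw [hc1] at h3
  refine ⟨mfderiv 𝓘(ℂ, E) 𝓘(ℂ, E) c 1 X, h3.trans ?_⟩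
  simp [T, repDeriv, mul_assoc]
  rfl

theorem isLocallyConstant_of_hasMFDerivAt_zero {f : G → A}
    (hf : ∀ x, HasMFDerivAt 𝓘(ℂ, E) 𝓘(ℂ, A) f x (0 : E →L[ℂ] A)) : IsLocallyConstant f := by
  rw [IsLocallyConstant.iff_eventually_eq]
  intro x
  let φ := extChartAt 𝓘(ℂ, E) x
  obtain ⟨δ, hδ, hball⟩ := Metric.mem_nhds_iff.1 (extChartAt_target_mem_nhds (I := 𝓘(ℂ, E)) x)
  have hder : ∀ y ∈ Metric.ball (φ x) δ, HasFDerivAt (𝕜 := ℂ) (f ∘ φ.symm) (0 : E →L[ℂ] A) y := by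
    intro y hy
    have hs : MDifferentiableAt 𝓘(ℂ, E) 𝓘(ℂ, E) φ.symm y :=
      ((contMDiffOn_extChartAt_symm (n := ω) x).contMDiffAt
        ((isOpen_extChartAt_target x).mem_nhds (hball hy))).mdifferentiableAt (by simp)
    have := (hf (φ.symm y)).comp y hs.hasMFDerivAt
    rw [hasMFDerivAt_iff_hasFDerivAt] at this
    exact this.congr_fderiv (ContinuousLinearMap.zero_comp _)
  have hev : ∀ᶠ z in 𝓝 x, φ z ∈ Metric.ball (φ x) δ :=
    (continuousAt_extChartAt x).eventually (Metric.ball_mem_nhds _ hδ)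
  filter_upwards [hev, extChartAt_source_mem_nhds (I := 𝓘(ℂ, E)) x] with z hz hz'
  have := (convex_ball (φ x) δ).is_const_of_fderivWithin_eq_zero (𝕜 := ℂ) (f := f ∘ φ.symm)
    (fun s hs ↦ (hder s hs).differentiableAt.differentiableWithinAt) (fun s hs ↦ by
      rw [fderivWithin_of_isOpen Metric.isOpen_ball hs, (hder s hs).fderiv]) hz
    (Metric.mem_ball_self hδ)
  rw [Function.comp_apply, Function.comp_apply, (extChartAt 𝓘(ℂ, E) x).left_inv hz',
    extChartAt_to_inv] at this
  exact this

/-- If `c` commutes with the image of the derivative of a representation, then its conjugates by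
the image of the representation are locally constant. -/
theorem isLocallyConstant_conj (hF : ContMDiff 𝓘(ℂ, E) 𝓘(ℂ, A) ω F) {c : A}
    (hc : ∀ X : GroupLieAlgebra 𝓘(ℂ, E) G, Commute (repDeriv F X) c) :
    IsLocallyConstant fun g ↦ F g * c * F g⁻¹ := by
  set f : G → A := fun g ↦ F g * c * F g⁻¹ with hf
  have hd : ∀ g, MDifferentiableAt 𝓘(ℂ, E) 𝓘(ℂ, A) F g := fun g ↦ hF.mdifferentiable (by simp) g
  have hd' : MDifferentiableAt 𝓘(ℂ, E) 𝓘(ℂ, A) (fun g ↦ F g⁻¹) 1 :=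
    (hF.comp (contMDiff_inv 𝓘(ℂ, E) ω)).mdifferentiable (by simp) 1
  have hfd : MDifferentiableAt 𝓘(ℂ, E) 𝓘(ℂ, A) f 1 :=
    ((hd 1).mul mdifferentiableAt_const).mul hd'
  -- Differentiating this product identity at `1` avoids computing the derivative of inversion.
  have hfF : f * F = fun g ↦ F g * c := by
    ext g
    simp [hf, mul_assoc, ← map_mul]
  have h1 : HasMFDerivAt 𝓘(ℂ, E) 𝓘(ℂ, A) f 1 (0 : E →L[ℂ] A) := by
    have e1 := hfd.hasMFDerivAt.mul' (hd 1).hasMFDerivAt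
    have e2 := (hd 1).hasMFDerivAt.mul' (hasMFDerivAt_const (I := 𝓘(ℂ, E)) c (1 : G))
    have e3 : f * ⇑F = ⇑F * fun _ ↦ c := hfF
    rw [← e3] at e2
    have e4 := hasMFDerivAt_unique e1 e2
    have e5 : mfderiv 𝓘(ℂ, E) 𝓘(ℂ, A) f 1 = (0 : E →L[ℂ] A) := by
      refine ContinuousLinearMap.ext fun X ↦ ?_
      let d : A := mfderiv 𝓘(ℂ, E) 𝓘(ℂ, A) f 1 X
      have : f 1 * repDeriv F X + d * F 1 = F 1 * 0 + repDeriv F X * c :=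
        congrArg (fun S : E →L[ℂ] A ↦ S X) e4
      have hf1 : f 1 = c := by simp [hf]
      rw [hf1, (hc X).eq, map_one, mul_zero, zero_add, mul_one, add_eq_left] at this
      exact this
    rw [← e5]
    exact hfd.hasMFDerivAt
  refine isLocallyConstant_of_hasMFDerivAt_zero (E := E) fun x ↦ ?_
  let T : A →L[ℂ] A :=
    (ContinuousLinearMap.mul ℂ A (F x)).comp ((ContinuousLinearMap.mul ℂ A).flip (F x⁻¹))
  -- Left translation carries the vanishing of the derivative from `1` to `x`.
  have hT : f = T ∘ f ∘ (x⁻¹ * ·) := by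
    ext k
    simp [hf, T, ← mul_assoc, ← map_mul]
    simp [mul_assoc, ← map_mul]
  rw [hT]
  have h2 : HasMFDerivAt 𝓘(ℂ, E) 𝓘(ℂ, A) f (x⁻¹ * x) (0 : E →L[ℂ] A) := by
    rw [inv_mul_cancel]; exact h1
  have h3 := h2.comp x (((contMDiff_mul_left (I := 𝓘(ℂ, E)) (n := ω) (a := x⁻¹)).mdifferentiable
    (by simp)) x).hasMFDerivAt
  have h4 := (T.hasMFDerivAt (x := f (x⁻¹ * x))).comp x h3
  have h5 : ∀ S : E →L[ℂ] E, T.comp ((0 : E →L[ℂ] A).comp S) = 0 := fun S ↦ by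
    rw [ContinuousLinearMap.zero_comp, ContinuousLinearMap.comp_zero]
  exact h4.congr_mfderiv (h5 _)

/-- In a complex Lie group with finitely many components, some positive power of every element acts
trivially on the commutant of the image of the derivative of a representation. -/
theorem exists_pow_commute [Finite (ConnectedComponents G)]
    (hF : ContMDiff 𝓘(ℂ, E) 𝓘(ℂ, A) ω F) (u : G) :
    ∃ k : ℕ, 0 < k ∧ ∀ c : A, (∀ X : GroupLieAlgebra 𝓘(ℂ, E) G, Commute (repDeriv F X) c) →
      Commute (F u ^ k) c := by
  -- Pigeonhole: two powers of `u` share a component, hence conjugate `c` alike, so their quotient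
  -- commutes with `c`.
  obtain ⟨i, j, hij, h⟩ : ∃ i j : ℕ, i < j ∧
      ((u ^ i : G) : ConnectedComponents G) = ((u ^ j : G) : ConnectedComponents G) := by
    obtain ⟨i, j, hne, h⟩ := Finite.exists_ne_map_eq_of_infinite
      (fun n : ℕ ↦ ((u ^ n : G) : ConnectedComponents G))
    obtain hlt | hlt := hne.lt_or_gt
    exacts [⟨i, j, hlt, h⟩, ⟨j, i, hlt, h.symm⟩]
  obtain ⟨k, rfl⟩ := Nat.exists_eq_add_of_lt hij
  refine ⟨k + 1, k.succ_pos, fun c hc ↦ ?_⟩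
  have hconst := (isLocallyConstant_conj hF hc).apply_eq_of_isPreconnected
    isPreconnected_connectedComponent (ConnectedComponents.coe_eq_coe'.1 h)
    (mem_connectedComponent (x := u ^ (i + k + 1)))
  have e1 : F (u ^ i)⁻¹ * F (u ^ i) = 1 := by rw [← map_mul, inv_mul_cancel, map_one]
  have e2 : F (u ^ (i + k + 1)) = F (u ^ i) * F (u ^ (k + 1)) := by
    rw [← map_mul, ← pow_add, add_assoc]
  have e3 : F (u ^ (i + k + 1))⁻¹ * F (u ^ (i + k + 1)) = 1 := by
    rw [← map_mul, inv_mul_cancel, map_one]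
  have e4 := congrArg (fun a ↦ F (u ^ i)⁻¹ * (a * F (u ^ (i + k + 1)))) hconst
  simp only [mul_assoc, e3, mul_one] at e4
  rw [e2] at e4
  simp only [← mul_assoc, e1, one_mul] at e4
  rw [← map_pow]
  exact e4.symm

end ComponentGroup

/-! ### Conjugating `N` to `-N` and conclusion. -/

section Main

attribute [local instance 100] LieRing.ofAssociativeRing

/-- A map into a finite-dimensional matrix algebra is analytic if its entries are. -/
theorem contMDiff_of_matrix_entries {E G A : Type*} [NormedAddCommGroup E] [NormedSpace ℂ E]
    [TopologicalSpace G] [ChartedSpace E G] [NormedRing A] [NormedAlgebra ℂ A] {n : ℕ}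
    (e : A ≃ₐ[ℂ] Matrix (Fin n) (Fin n) ℂ) {f : G → A}
    (hf : ∀ i j, ContMDiff 𝓘(ℂ, E) 𝓘(ℂ, ℂ) ω fun g ↦ e (f g) i j) :
    ContMDiff 𝓘(ℂ, E) 𝓘(ℂ, A) ω f := by
  have h : f = fun g ↦ ∑ i, ∑ j, e (f g) i j • e.symm (Matrix.single i j (1 : ℂ)) := by
    ext1 g
    apply e.injective
    conv_lhs => rw [Matrix.matrix_eq_sum_single (e (f g))]
    simp [Matrix.smul_single]
  rw [h]
  refine contMDiff_finsetSum fun i _ ↦ contMDiff_finsetSum fun j _ ↦ ?_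
  exact (hf i j).smul contMDiff_const

/-- The exponential series of a nilpotent element agrees with the polynomial exponential. -/
theorem NormedSpace.exp_eq_of_isNilpotent {A : Type*} [NormedRing A] [NormedAlgebra ℚ A] {N : A}
    (hN : IsNilpotent N) : NormedSpace.exp N = IsNilpotent.exp N := by
  obtain ⟨k, hk⟩ := hN
  rw [IsNilpotent.exp_eq_sum hk, NormedSpace.exp_eq_tsum ℚ]
  refine tsum_eq_sum fun i hi ↦ ?_
  rw [pow_eq_zero_of_le (by simpa using hi) hk, smul_zero]

/-- Version of `exists_lie_eq_two_smul` for an algebra isomorphic to a matrix algebra. -/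
theorem exists_lie_eq_two_smul_of_algEquiv {K L : Type*} [Field K] [CharZero K] [LieRing L]
    [LieAlgebra K L] [FiniteDimensional K L] [LieAlgebra.IsKilling K L] {n : Type*} [Fintype n]
    [DecidableEq n] {A : Type*} [Ring A] [Algebra K A] (e : A ≃ₐ[K] Matrix n n K)
    {φ : L →ₗ⁅K⁆ A} (hinj : Function.Injective φ) {N : A}
    (hnil : IsNilpotent N) (hN : ∀ x, ∃ y, φ y = ⁅N, φ x⁆)
    (hcomm : ∀ c, (∀ x, Commute (φ x) c) → Commute N c) :
    ∃ h : L, ⁅φ h, N⁆ = (2 : K) • N := by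
  obtain ⟨h, hh⟩ := exists_lie_eq_two_smul (φ := (e : A →ₐ[K] Matrix n n K).toLieHom.comp φ)
    (N := e N) (e.injective.comp hinj) (hnil.map e)
    (fun x ↦ by
      obtain ⟨y, hy⟩ := hN x
      exact ⟨y, by simp [hy, Ring.lie_def]⟩)
    (fun c hc ↦ by
      have := (hcomm (e.symm c) fun x ↦ ?_).map e
      · simpa using this
      · simpa using (hc x).map e.symm)
  refine ⟨h, e.injective ?_⟩
  simpa [Ring.lie_def] using hh

/-- If `h * y - y * h = 2 • y`, then conjugation by `exp (π i h / 2)` maps `y` to `-y`. -/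
theorem exp_semiconj_neg {A : Type*} [NormedRing A] [NormedAlgebra ℂ A] [CompleteSpace A]
    {h y : A} (hy : h * y - y * h = (2 : ℂ) • y) :
    NormedSpace.exp ((Real.pi * Complex.I / 2 : ℂ) • h) * y =
      -y * NormedSpace.exp ((Real.pi * Complex.I / 2 : ℂ) • h) := by
  let _ : NormedAlgebra ℚ A := NormedAlgebra.restrictScalars ℚ ℂ A
  set s : ℂ := Real.pi * Complex.I / 2 with hs
  -- Exponentiating this relation produces the scalar `exp (2 * s) = exp (π i) = -1`.
  have h1 : SemiconjBy y (s • h + algebraMap ℂ A (2 * s)) (s • h) := by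
    rw [SemiconjBy, mul_add, ← Algebra.commutes, ← Algebra.smul_def, mul_smul_comm,
      smul_mul_assoc, sub_eq_iff_eq_add.1 hy, smul_add, smul_smul, mul_comm s, add_comm]
  have h2 := h1.exp_right
  have h3 : NormedSpace.exp (algebraMap ℂ A (2 * s)) = -1 := by
    rw [← NormedSpace.algebraMap_exp_comm, ← Complex.exp_eq_exp_ℂ]
    have : 2 * s = Real.pi * Complex.I := by rw [hs]; ring
    rw [this, Complex.exp_pi_mul_I, map_neg, map_one]
  rw [NormedSpace.exp_add_of_commute (Algebra.commutes _ _).symm, h3] at h2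
  rw [← h2.eq, mul_neg_one, mul_neg, neg_mul]

/-- The derivative of a representation as a homomorphism of Lie algebras. -/
noncomputable def repDerivLieHom {E : Type*} [NormedAddCommGroup E] [NormedSpace ℂ E]
    [CompleteSpace E] {G : Type*} [Group G] [TopologicalSpace G] [ChartedSpace E G]
    [LieGroup 𝓘(ℂ, E) ω G] {A : Type*} [NormedRing A] [NormedAlgebra ℂ A] {F : G →* A}
    (hF : ContMDiff 𝓘(ℂ, E) 𝓘(ℂ, A) ω F) : GroupLieAlgebra 𝓘(ℂ, E) G →ₗ⁅ℂ⁆ A :=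
  { (repDeriv (E := E) F).toLinearMap with
    map_lie' := fun {X Y} ↦ repDeriv_lie hF X Y }

/-- Unipotent elements are real, for a faithful analytic homomorphism to a matrix algebra. -/
theorem isRealElement_of_isNilpotent_sub_one {E : Type*} [NormedAddCommGroup E] [NormedSpace ℂ E]
    [FiniteDimensional ℂ E] [CompleteSpace E] {G : Type*} [Group G] [TopologicalSpace G]
    [ChartedSpace E G] [LieGroup 𝓘(ℂ, E) ω G] [Finite (ConnectedComponents G)]
    [LieAlgebra.IsSemisimple ℂ (GroupLieAlgebra 𝓘(ℂ, E) G)] {A : Type*} [NormedRing A]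
    [NormedAlgebra ℂ A] [CompleteSpace A] {n : ℕ} (e : A ≃ₐ[ℂ] Matrix (Fin n) (Fin n) ℂ)
    {F : G →* A} (hF : ContMDiff 𝓘(ℂ, E) 𝓘(ℂ, A) ω F) (hinj : Function.Injective F) {u : G}
    (hu : IsNilpotent (F u - 1)) : IsRealElement u := by
  have : FiniteDimensional ℂ (GroupLieAlgebra 𝓘(ℂ, E) G) := inferInstanceAs (FiniteDimensional ℂ E)
  let _ : NormedAlgebra ℚ A := NormedAlgebra.restrictScalars ℚ ℂ A
  obtain ⟨N, hN, hNu⟩ := IsNilpotent.exists_exp_eq hu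
  have hpow : ∀ m : ℕ, IsNilpotent.exp (m • N) = F (u ^ m) := fun m ↦ by
    rw [IsNilpotent.exp_nsmul hN, hNu, map_pow]
  have hpow' : ∀ m : ℕ, IsNilpotent.exp (-(m • N)) = F (u ^ m)⁻¹ := fun m ↦ by
    have h1 := IsNilpotent.exp_neg_mul_exp_self (hN.smul m)
    rw [hpow] at h1
    have h2 : F (u ^ m) * F (u ^ m)⁻¹ = 1 := by rw [← map_mul, mul_inv_cancel, map_one]
    exact left_inv_eq_right_inv h1 h2
  let φ := repDerivLieHom hF
  obtain ⟨k, hk, hkc⟩ := exists_pow_commute (E := E) hF u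
  obtain ⟨h, hh⟩ : ∃ h, ⁅φ h, N⁆ = (2 : ℂ) • N := by
    refine exists_lie_eq_two_smul_of_algEquiv e (repDeriv_injective hF hinj) hN (fun x ↦ ?_)
      fun c hc ↦ ?_
    · refine mul_sub_mul_mem_of_exp_conj_sub_mem (K := ℂ) hN
        (LinearMap.range (repDeriv (E := E) F).toLinearMap) fun m ↦ ?_
      rw [hpow, hpow']
      obtain ⟨Y, hY⟩ := exists_repDeriv_eq_conj hF (u ^ m) x
      exact Submodule.sub_mem _ ⟨Y, hY⟩ ⟨x, rfl⟩
    -- Only the powers of `u ^ k` are known to commute with `c`, so the polynomial argument is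
    -- applied to `k • N` modulo `⊥`, and `k ≠ 0` is divided out.
    · have h0 := mul_sub_mul_mem_of_exp_conj_sub_mem (K := ℂ) (hN.smul k) ⊥ (x := c) fun m ↦ by
        have hcm : Commute (F (u ^ (k * m))) c := by
          rw [pow_mul, map_pow, map_pow]
          exact (hkc c hc).pow_left m
        rw [smul_smul, hpow, hpow', Submodule.mem_bot, sub_eq_zero, mul_comm m, hcm.eq, mul_assoc,
          ← map_mul, mul_inv_cancel, map_one, mul_one]
      rw [Submodule.mem_bot, smul_mul_assoc, mul_smul_comm, ← smul_sub,
        ← Nat.cast_smul_eq_nsmul ℂ, smul_eq_zero, Nat.cast_eq_zero] at h0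
      exact sub_eq_zero.1 (h0.resolve_left hk.ne')
  obtain ⟨g, hg⟩ := exists_eq_exp_repDeriv hF ((Real.pi * Complex.I / 2 : ℂ) • h)
  have hgN : F g * N = -N * F g := by
    rw [hg, map_smul]
    exact exp_semiconj_neg hh
  refine ⟨g, hinj ?_⟩
  have hexp : SemiconjBy (F g) (NormedSpace.exp N) (NormedSpace.exp (-N)) :=
    SemiconjBy.exp_right hgN
  rw [NormedSpace.exp_eq_of_isNilpotent hN, NormedSpace.exp_eq_of_isNilpotent hN.neg, hNu] at hexp
  have h1 := hpow' 1
  rw [one_smul, pow_one] at h1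
  rw [map_mul, map_mul, hexp.eq, h1, mul_assoc, ← map_mul F g, mul_inv_cancel, map_one, mul_one]

theorem mainTheorem10
    {E : Type*} [NormedAddCommGroup E] [NormedSpace ℂ E] [FiniteDimensional ℂ E] [CompleteSpace E]
    {G : Type*} [Group G] [TopologicalSpace G] [ChartedSpace E G] [LieGroup 𝓘(ℂ, E) ω G]
    [Finite (ConnectedComponents G)]
    [LieAlgebra.IsSemisimple ℂ (GroupLieAlgebra 𝓘(ℂ, E) G)]
    (u : G) (hu : IsUnipotentElement E u) :
    IsRealElement u := by
  obtain ⟨n, ρ, hinj, hρ, hnil⟩ := hu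
  -- Operators on Euclidean space model the matrix algebra as a complete normed algebra, where
  -- exponentials and derivatives make sense.
  let e := (Matrix.toEuclideanCLM (n := Fin n) (𝕜 := ℂ)).symm.toAlgEquiv
  let F : G →* (EuclideanSpace ℂ (Fin n) →L[ℂ] EuclideanSpace ℂ (Fin n)) :=
    (e.symm : Matrix (Fin n) (Fin n) ℂ →* _).comp ((Units.coeHom _).comp ρ)
  have heF : ∀ g, e (F g) = ρ g := fun g ↦ e.apply_symm_apply _
  refine isRealElement_of_isNilpotent_sub_one (E := E) e (F := F)
    (contMDiff_of_matrix_entries e fun i j ↦ ?_) (fun a b hab ↦ ?_) ?_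
  · simpa only [heF] using hρ i j
  · refine hinj (Units.ext ?_)
    rw [← heF, ← heF, hab]
  · have := hnil.map e.symm
    rwa [map_sub, map_one, ← heF, e.symm_apply_apply] at this

end Main
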